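/- Let $\lambda$ be an infinite regular cardinal and let $\mathcal{C}$ be a locally $\lambda$-presentable category. A morphism $f\colon A\to B$ of $\mathcal{C}$ is called $\lambda$-pure if for every commutative square $fu=vz$ with $z\colon X\to Y$ a morphism between $\lambda$-presentable objects, $u\colon X\to A$ and $v\colon Y\to B$, there exists $d\colon Y\to A$ with $dz=u$. An object $A$ of $\mathcal{C}$ is called absolutely $\lambda$-pure if every monomorphism with domain $A$ is $\lambda$-pure. Assume that every transfinite composition of monomorphisms in $\mathcal{C}$ is a monomorphism; that is, for every (small) nonzero ordinal $\delta$ and every functor $F\colon\delta\to\mathcal{C}$ such that $F(\beta)\to F(\beta+1)$ is a monomorphism whenever $\beta+1<\delta$ and $F(\beta)=\operatorname{colim}_{\gamma<\beta}F(\gamma)$ for every limit ordinal $\beta<\delta$, the canonical morphism $F(0)\to\operatorname{colim}F$ is a monomorphism. Then $\mathcal{C}$ has enough absolutely $\lambda$-pure objects: for every object $A$ of $\mathcal{C}$ there exists a monomorphism $A\to A^*$ with $A^*$ absolutely $\lambda$-pure. -/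

import Mathlib

universe w v u

open CategoryTheory

/-- For a regular cardinal `κ`, a morphism `f : A ⟶ B` is `κ`-pure if, for every commutative square
`u ≫ f = z ≫ v` with `z : X ⟶ Y` a morphism between `κ`-presentable objects, the morphism
`u : X ⟶ A` factors through `z`. -/
def IsCardinalPure {C : Type u} [Category.{v} C] (κ : Cardinal.{w}) [Fact κ.IsRegular]
    {A B : C} (f : A ⟶ B) : Prop :=
  ∀ ⦃X Y : C⦄ [IsCardinalPresentable X κ] [IsCardinalPresentable Y κ]
    (z : X ⟶ Y) (u : X ⟶ A) (v : Y ⟶ B), u ≫ f = z ≫ v → ∃ d : Y ⟶ A, z ≫ d = u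

/-- An object `A` is absolutely `κ`-pure if every monomorphism with domain `A` is `κ`-pure. -/
def IsAbsolutelyCardinalPure {C : Type u} [Category.{v} C] (κ : Cardinal.{w}) [Fact κ.IsRegular]
    (A : C) : Prop :=
  ∀ ⦃B : C⦄ (f : A ⟶ B) [Mono f], IsCardinalPure κ f

/-!
Call a span `Y ⟵ X ⟶ A`, with legs `z` and `u` and with `X`, `Y` presentable for `κ`, solved by a
morphism `i : A ⟶ B` if `u ≫ i` factors through `z`. Then `A` is absolutely `κ`-pure exactly when
the identity of `A` solves every span on `A` that some monomorphism out of `A` solves.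

The proof has two layers of transfinite iteration.

* Up to isomorphism of `X` and `Y`, the spans on `A` form a small set, and the set of spans solved
  by `i` can only grow when `i` is composed with further morphisms. As transfinite compositions of
  monomorphisms are monomorphisms, there is a monomorphism `i : A ⟶ A'` such that no monomorphism
  out of `A'` solves more of the spans on `A` than `i` does: otherwise the set of solved spans could
  be strictly enlarged more times than there are sets of spans
  (`MorphismProperty.exists_maximal_of_isStableUnderTransfiniteComposition`, applied in the
  category `Under A`). This gives `exists_mono_forall_span`. No pushouts of monomorphisms are
  needed, which matters because these need not be monomorphisms.
* The step `A ⟶ A'` is iterated `κ` times. As `κ` is regular, the colimit is `κ`-filtered, so a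
  morphism `X ⟶ A*` from a `κ`-presentable object factors through some stage `j`. If the span it
  is part of is solved by a monomorphism out of `A*`, then the composite of that monomorphism with
  the inclusion of stage `j + 1` is a monomorphism, so the span was already solved at
  stage `j + 1`.
-/

open Limits

namespace CategoryTheory

instance Under.preservesWellOrderContinuousOfShape_forget {C : Type u} [Category.{v} C] (A : C)
    (J : Type w) [LinearOrder J] :
    PreservesWellOrderContinuousOfShape J (Under.forget A) where
  preservesColimitsOfShape j hj := by
    have := hj.nonempty_Iio.to_subtype
    have : IsConnected (Set.Iio j) := IsFiltered.isConnected _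
    infer_instance

/-- Well-orders with a least element are connected, so `Under.forget A` preserves the colimits that
occur in transfinite compositions. -/
lemma MorphismProperty.isStableUnderTransfiniteComposition_inverseImage_underForget
    {C : Type u} [Category.{v} C] (W : MorphismProperty C)
    [IsStableUnderTransfiniteComposition.{w} W] (A : C) :
    IsStableUnderTransfiniteComposition.{w} (W.inverseImage (CategoryTheory.Under.forget A)) where
  isStableUnderTransfiniteCompositionOfShape J _ _ _ _ :=
    { le X Y f hf := by
        have : IsConnected J := IsFiltered.isConnected _
        exact W.transfiniteCompositionsOfShape_le J _
          (transfiniteCompositionsOfShape_map_of_preserves J (CategoryTheory.Under.forget A) f hf) }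

lemma MorphismProperty.TransfiniteCompositionOfShape.mem_isoBot_inv_comp_map
    {D : Type u} [Category.{v} D] {W : MorphismProperty D}
    [IsStableUnderTransfiniteComposition.{w} W]
    {J : Type w} [LinearOrder J] [SuccOrder J] [OrderBot J] [WellFoundedLT J]
    {X Y : D} {f : X ⟶ Y} (h : W.TransfiniteCompositionOfShape J f) (j : J) :
    W (h.isoBot.inv ≫ h.F.map (homOfLE bot_le : ⊥ ⟶ j)) := by
  let e : CategoryTheory.Arrow.mk (h.F.map (homOfLE bot_le : ⊥ ⟶ j)) ≅
      CategoryTheory.Arrow.mk (h.isoBot.inv ≫ h.F.map (homOfLE bot_le : ⊥ ⟶ j)) :=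
    CategoryTheory.Arrow.isoMk h.isoBot (Iso.refl _)
  exact W.transfiniteCompositionsOfShape_le _ _ ((h.iic j).ofArrowIso e).mem

/-- Let `σ` assign to each object a subset of a fixed small set, increasing along morphisms. Above
every object there is, along a morphism of `W`, an object whose subset no further morphism of `W`
enlarges. Otherwise the subset could be enlarged strictly at every step of a transfinite iteration
along `W`, and an iteration longer than the number of subsets would inject its index set
into `Set S`. -/
lemma MorphismProperty.exists_maximal_of_isStableUnderTransfiniteComposition
    {D : Type u} [Category.{v} D] [HasColimitsOfSize.{w, w} D] (W : MorphismProperty D)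
    [IsStableUnderTransfiniteComposition.{w} W] {S : Type*} [Small.{w} S] (σ : D → Set S)
    (hσ : ∀ ⦃X Y : D⦄ (_ : X ⟶ Y), σ X ⊆ σ Y) (X : D) :
    ∃ (Y : D) (f : X ⟶ Y), W f ∧ ∀ ⦃Z : D⦄ (g : Y ⟶ Z), W g → σ Z ⊆ σ Y := by
  by_contra! h
  -- The hypothesis `h` only concerns objects reached from `X` by a morphism of `W`, whereas a
  -- successor structure needs a successor of every object; elsewhere the identity is used.
  have key (Y : D) : ∃ (Z : D) (g : Y ⟶ Z), W g ∧
      ((∃ f : X ⟶ Y, W f) → σ Y ⊂ σ Z) := by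
    by_cases hY : ∃ f : X ⟶ Y, W f
    · obtain ⟨f, hf⟩ := hY
      obtain ⟨Z, g, hg, hZ⟩ := h Y f hf
      exact ⟨Z, g, hg, fun _ ↦ ⟨hσ g, hZ⟩⟩
    · exact ⟨Y, 𝟙 Y, W.id_mem Y, fun hY' ↦ (hY hY').elim⟩
  choose s t ht hst using key
  let Φ : SmallObject.SuccStruct D := { X₀ := X, succ := s, toSucc := t }
  let c : Cardinal.{w} := Order.succ (max Cardinal.aleph0 (Cardinal.mk (Set (Shrink.{w} S))))
  have hc : Cardinal.aleph0 ≤ c := (le_max_left _ _).trans (Order.le_succ _)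
  have : NoMaxOrder c.ord.ToType := Cardinal.noMaxOrder hc
  have : Nonempty c.ord.ToType := by
    rw [← Cardinal.mk_ne_zero_iff, Cardinal.mk_ord_toType]
    exact (Cardinal.aleph0_pos.trans_le hc).ne'
  let _ : OrderBot c.ord.ToType := WellFoundedLT.toOrderBot _
  let _ : SuccOrder c.ord.ToType := SuccOrder.ofLinearWellFoundedLT _
  let T : W.TransfiniteCompositionOfShape c.ord.ToType (Φ.ιIteration c.ord.ToType) :=
    (Φ.transfiniteCompositionOfShapeιIteration c.ord.ToType).ofLE (by
      rintro _ _ _ ⟨Y⟩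
      exact ht _)
  let F := Φ.iterationFunctor c.ord.ToType
  have hX (j : c.ord.ToType) : ∃ f : X ⟶ F.obj j, W f :=
    ⟨_, T.mem_isoBot_inv_comp_map j⟩
  have hlt (j : c.ord.ToType) : σ (F.obj j) ⊂ σ (F.obj (Order.succ j)) :=
    (hst (F.obj j) (hX j)).trans_subset
      (hσ (Φ.iterationFunctorObjSuccIso j (not_isMax j)).inv)
  have hmono : StrictMono fun j ↦ σ (F.obj j) := fun i j hij ↦
    (hlt i).trans_subset (hσ (F.map (homOfLE (Order.succ_le_of_lt hij))))
  have hcard := Cardinal.mk_le_of_injective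
    ((Equiv.Set.congr (equivShrink.{w} S)).injective.comp hmono.injective)
  rw [Cardinal.mk_ord_toType] at hcard
  exact ((le_max_right _ _).trans_lt (Order.lt_succ _)).not_ge hcard

end CategoryTheory

/-- The successor step: every object `A` has a monomorphism `i` to some `A'` such that a span on `A`
which is solved after composing `i` with a monomorphism out of `A'` is already solved by `i`. -/
lemma exists_mono_forall_span {C : Type u} [Category.{v} C] (κ : Cardinal.{w})
    [Fact κ.IsRegular] [IsCardinalLocallyPresentable C κ]
    [MorphismProperty.IsStableUnderTransfiniteComposition.{w}
      (MorphismProperty.monomorphisms C)] (A : C) :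
    ∃ (A' : C) (i : A ⟶ A'), Mono i ∧
      ∀ ⦃X Y : C⦄ [IsCardinalPresentable X κ] [IsCardinalPresentable Y κ]
        (z : X ⟶ Y) (u : X ⟶ A) ⦃B : C⦄ (g : A' ⟶ B) [Mono g] (v : Y ⟶ B),
        u ≫ i ≫ g = z ≫ v → ∃ d : Y ⟶ A', z ≫ d = u ≫ i := by
  obtain ⟨P, _, -, hP⟩ := ObjectProperty.EssentiallySmall.exists_small_le
    (isCardinalPresentable C κ)
  have := MorphismProperty.isStableUnderTransfiniteComposition_inverseImage_underForget.{w}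
    (MorphismProperty.monomorphisms C) A
  -- The spans on `A`, with `X` and `Y` in a small set `P` of representatives.
  let S := Σ (X Y : Subtype P), (X.1 ⟶ Y.1) × (X.1 ⟶ A)
  let σ (B : Under A) : Set S :=
    {s | ∃ d : s.2.1.1 ⟶ B.right, s.2.2.1 ≫ d = s.2.2.2 ≫ B.hom}
  obtain ⟨A', i, hi, hA'⟩ :=
    MorphismProperty.exists_maximal_of_isStableUnderTransfiniteComposition.{w}
      ((MorphismProperty.monomorphisms C).inverseImage (Under.forget A)) σ
      (fun B B' f ↦ by
        rintro s ⟨d, hd⟩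
        exact ⟨d ≫ f.right, by rw [reassoc_of% hd, Under.w]⟩)
      (Under.mk (𝟙 A))
  have hi' : i.right = A'.hom := by simpa using Under.w i
  refine ⟨A'.right, A'.hom, hi' ▸ hi, fun X Y hX hY z u B g _ v h ↦ ?_⟩
  obtain ⟨X', hX', ⟨e⟩⟩ := hP X hX
  obtain ⟨Y', hY', ⟨e'⟩⟩ := hP Y hY
  obtain ⟨d, hd⟩ := hA' (Under.homMk g : A' ⟶ Under.mk (A'.hom ≫ g)) ‹Mono g›
    (show (⟨⟨X', hX'⟩, ⟨Y', hY'⟩, e.inv ≫ z ≫ e'.hom, e.inv ≫ u⟩ : S) ∈ _ from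
      ⟨e'.inv ≫ v, by simp [h]⟩)
  exact ⟨e'.hom ≫ d, by simpa using hd⟩

theorem mainTheorem6 {C : Type u} [Category.{v} C] (κ : Cardinal.{w}) [Fact κ.IsRegular]
    [IsCardinalLocallyPresentable C κ]
    (hmono : MorphismProperty.IsStableUnderTransfiniteComposition.{w}
      (MorphismProperty.monomorphisms C))
    (A : C) :
    ∃ (A' : C) (i : A ⟶ A'), Mono i ∧ IsAbsolutelyCardinalPure κ A' := by
  choose s t ht hst using exists_mono_forall_span (C := C) κ
  let Φ : SmallObject.SuccStruct C := { X₀ := A, succ := s, toSucc := t }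
  have hκ : Cardinal.aleph0 ≤ κ := (Fact.out : κ.IsRegular).aleph0_le
  have : NoMaxOrder κ.ord.ToType := Cardinal.noMaxOrder hκ
  have : Nonempty κ.ord.ToType := by
    rw [← Cardinal.mk_ne_zero_iff, Cardinal.mk_ord_toType]
    exact (Cardinal.aleph0_pos.trans_le hκ).ne'
  let _ : OrderBot κ.ord.ToType := WellFoundedLT.toOrderBot _
  let _ : SuccOrder κ.ord.ToType := SuccOrder.ofLinearWellFoundedLT _
  let T : (MorphismProperty.monomorphisms C).TransfiniteCompositionOfShape κ.ord.ToType
      (Φ.ιIteration κ.ord.ToType) :=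
    (Φ.transfiniteCompositionOfShapeιIteration κ.ord.ToType).ofLE (by
      rintro _ _ _ ⟨Y⟩
      exact ht _)
  refine ⟨Φ.iteration κ.ord.ToType, Φ.ιIteration κ.ord.ToType,
    (MorphismProperty.monomorphisms C).transfiniteCompositionsOfShape_le _ _ T.mem,
    fun B f _ X Y _ _ z u v h ↦ ?_⟩
  obtain ⟨j, u', hu⟩ := IsCardinalPresentable.exists_hom_of_isColimit κ T.isColimit u
  let e : T.F.obj (Order.succ j) ≅ s (T.F.obj j) := Φ.iterationFunctorObjSuccIso j (not_isMax j)
  -- The inclusion of stage `j + 1`, seen as a monomorphism out of the successor of stage `j`.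
  let k : s (T.F.obj j) ⟶ Φ.iteration κ.ord.ToType := e.inv ≫ T.incl.app (Order.succ j)
  have hk : t (T.F.obj j) ≫ k = T.incl.app j := by
    have h₁ : T.F.map (homOfLE (Order.le_succ j)) = t (T.F.obj j) ≫ e.inv :=
      Φ.iterationFunctor_map_succ j (not_isMax j)
    have h₂ := T.incl.naturality (homOfLE (Order.le_succ j))
    rw [h₁] at h₂
    simpa [k] using h₂
  have : Mono (T.incl.app (Order.succ j)) := T.mem_incl_app _
  have : Mono k := mono_comp _ _
  obtain ⟨d, hd⟩ := hst (T.F.obj j) z u' (k ≫ f) v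
    (by rw [reassoc_of% hk, ← h, ← hu, Category.assoc])
  exact ⟨d ≫ k, by rw [reassoc_of% hd, hk, hu]⟩
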